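/- Let $S$ be a closed orientable surface of genus $g\ge 2$, with fundamental group $\pi_1(S)=\langle a_1,b_1,\dots,a_g,b_g \mid [a_1,b_1]\cdots[a_g,b_g]\rangle$. For $n\ge 2$ let $\iota_n:\mathrm{SL}(2,\mathbf{R})\to\mathrm{SL}(n,\mathbf{R})$ be the irreducible representation, given by the action on binary forms of degree $n-1$, and give $\mathrm{Hom}(\pi_1(S),\mathrm{SL}(n,\mathbf{R}))$ the topology of pointwise convergence. A representation $\rho:\pi_1(S)\to\mathrm{SL}(n,\mathbf{R})$ is called a Hitchin representation if it lies in a Hitchin component, that is, in the connected component of $\iota_n\circ j$ in $\mathrm{Hom}(\pi_1(S),\mathrm{SL}(n,\mathbf{R}))$ for some discrete and faithful representation $j:\pi_1(S)\to\mathrm{SL}(2,\mathbf{R})$. Then for every $n\ge 2$ there exists a Hitchin representation $\rho:\pi_1(S)\to\mathrm{SL}(n,\mathbf{R})$ whose image is contained in $\mathrm{SL}(n,\mathbf{Q})$. -/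

import Mathlib

open scoped MatrixGroups

/-! ### Surface groups -/

/-- The surface relator `[a₁,b₁] [a₂,b₂] ⋯ [a_g,b_g]` in the free group on
`a₁, …, a_g` (the generators `Sum.inl i`) and `b₁, …, b_g` (the generators `Sum.inr i`). -/
def surfaceRelator (g : ℕ) : FreeGroup (Fin g ⊕ Fin g) :=
  (List.ofFn fun i : Fin g =>
    FreeGroup.of (Sum.inl i) * FreeGroup.of (Sum.inr i) *
      (FreeGroup.of (Sum.inl i))⁻¹ * (FreeGroup.of (Sum.inr i))⁻¹).prod

/-- The fundamental group of the closed orientable surface of genus `g`,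
`⟨a₁, b₁, …, a_g, b_g | [a₁,b₁] ⋯ [a_g,b_g]⟩`. -/
abbrev SurfaceGroup (g : ℕ) : Type :=
  PresentedGroup ({surfaceRelator g} : Set (FreeGroup (Fin g ⊕ Fin g)))

/-! ### The irreducible representation of `SL(2)` of dimension `n` -/

section SymPower

open Polynomial

/-- The matrix of the `(n-1)`-st symmetric power of `A = !![a, b; c, d]`. The substitution
`X ↦ a X + c Y`, `Y ↦ b X + d Y` acts on the binary forms of degree `n - 1`; in the basis
`X ^ (n-1-i) * Y ^ i`, `0 ≤ i < n`, the `i`-th column consists of the coefficients of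
`(a X + c Y) ^ (n-1-i) * (b X + d Y) ^ i`, which are read off here after setting
`X = 1` and taking `Y` as the polynomial variable. -/
noncomputable def symPowerMatrix {R : Type*} [CommRing R] (n : ℕ)
    (A : Matrix (Fin 2) (Fin 2) R) : Matrix (Fin n) (Fin n) R :=
  Matrix.of fun k i =>
    ((C (A 0 0) + C (A 1 0) * X) ^ (n - 1 - (i : ℕ)) *
      (C (A 0 1) + C (A 1 1) * X) ^ (i : ℕ) : R[X]).coeff k

theorem natDegree_symPower_linear_le {R : Type*} [CommRing R] (a c : R) :
    (C a + C c * X : R[X]).natDegree ≤ 1 := by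
  rw [add_comm]; exact natDegree_linear_le

theorem homogenize_symPower_linear_pow {R : Type*} [CommRing R] (a c : R) (m : ℕ) :
    ((C a + C c * X : R[X]) ^ m).homogenize m =
      (MvPolynomial.C a * MvPolynomial.X 1 + MvPolynomial.C c * MvPolynomial.X 0) ^ m := by
  have h := homogenize_finsetProd (s := Finset.range m)
    (p := fun _ => (C a + C c * X : R[X])) (n := fun _ => 1)
    (fun _ _ => natDegree_symPower_linear_le a c)
  simp only [Finset.prod_const, Finset.card_range, Finset.sum_const, smul_eq_mul, mul_one] at h
  rw [h]
  simp

theorem sum_coeff_mul_eq_aeval_homogenize {R : Type*} [CommRing R] (m : ℕ) (p u v : R[X]) :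
    ∑ k ∈ Finset.range (m + 1), C (p.coeff k) * (u ^ (m - k) * v ^ k) =
      MvPolynomial.aeval ![v, u] (p.homogenize m) := by
  rw [homogenize, map_sum, Finset.Nat.sum_antidiagonal_eq_sum_range_succ_mk]
  refine Finset.sum_congr rfl fun k _ => ?_
  simp [MvPolynomial.aeval_monomial, Finsupp.prod_fintype, Fin.prod_univ_two, mul_comm]

theorem symPowerMatrix_mul {R : Type*} [CommRing R] (n : ℕ) (A B : Matrix (Fin 2) (Fin 2) R) :
    symPowerMatrix n (A * B) = symPowerMatrix n A * symPowerMatrix n B := by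
  obtain _ | m := n
  · exact Subsingleton.elim _ _
  ext k i
  have hi : m - (i : ℕ) + (i : ℕ) = m := Nat.sub_add_cancel (Nat.lt_succ_iff.mp i.2)
  have key := sum_coeff_mul_eq_aeval_homogenize m
    ((C (B 0 0) + C (B 1 0) * X) ^ (m - (i : ℕ)) * (C (B 0 1) + C (B 1 1) * X) ^ (i : ℕ) : R[X])
    (C (A 0 0) + C (A 1 0) * X) (C (A 0 1) + C (A 1 1) * X)
  have hh : ((C (B 0 0) + C (B 1 0) * X) ^ (m - (i : ℕ)) *
      (C (B 0 1) + C (B 1 1) * X) ^ (i : ℕ) : R[X]).homogenize m =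
      ((C (B 0 0) + C (B 1 0) * X) ^ (m - (i : ℕ)) : R[X]).homogenize (m - (i : ℕ)) *
      ((C (B 0 1) + C (B 1 1) * X) ^ (i : ℕ) : R[X]).homogenize (i : ℕ) := by
    rw [← homogenize_mul, hi]
    · simpa using natDegree_pow_le_of_le (m - (i : ℕ)) (natDegree_symPower_linear_le (B 0 0) (B 1 0))
    · simpa using natDegree_pow_le_of_le (i : ℕ) (natDegree_symPower_linear_le (B 0 1) (B 1 1))
  rw [hh, homogenize_symPower_linear_pow, homogenize_symPower_linear_pow] at key
  have key2 := congrArg (fun q : R[X] => q.coeff k) key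
  simp only [finsetSum_coeff, coeff_C_mul] at key2
  rw [Finset.sum_range] at key2
  simp only [symPowerMatrix, Matrix.mul_apply, Matrix.of_apply, Nat.add_sub_cancel,
    Fin.sum_univ_two]
  simp only [mul_comm (coeff _ (k : ℕ))]
  rw [key2]
  congr 1
  simp
  ring

theorem det_symPowerMatrix_upper {R : Type*} [CommRing R] (n : ℕ) (x : R) :
    (symPowerMatrix n !![1, x; 0, 1]).det = 1 := by
  rw [Matrix.det_of_isUpperTriangular]
  · refine Finset.prod_eq_one fun i _ => ?_
    simpa [symPowerMatrix, add_comm] using coeff_X_add_C_pow x (i : ℕ) (i : ℕ)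
  · intro k i hik
    have h : (i : ℕ) < k := hik
    simpa [symPowerMatrix, add_comm, Nat.choose_eq_zero_of_lt h] using
      coeff_X_add_C_pow x (i : ℕ) (k : ℕ)

theorem det_symPowerMatrix_lower {R : Type*} [CommRing R] (n : ℕ) (x : R) :
    (symPowerMatrix n !![1, 0; x, 1]).det = 1 := by
  rw [Matrix.det_of_isLowerTriangular]
  · refine Finset.prod_eq_one fun i _ => ?_
    simp [symPowerMatrix, coeff_mul_X_pow', coeff_zero_eq_eval_zero]
  · intro k i hik
    have h : ¬ i ≤ k := not_le.mpr hik
    simp [symPowerMatrix, coeff_mul_X_pow', h]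

theorem det_symPowerMatrix {K : Type*} [Field K] (n : ℕ) (A : SL(2, K)) :
    (symPowerMatrix n (A : Matrix (Fin 2) (Fin 2) K)).det = 1 := by
  have step : ∀ M : Matrix (Fin 2) (Fin 2) K, M.det = 1 → M 1 0 ≠ 0 →
      (symPowerMatrix n M).det = 1 := by
    intro M hM hc
    rw [Matrix.det_fin_two] at hM
    have e : M = !![1, (M 0 0 - 1) / M 1 0; 0, 1] * !![1, 0; M 1 0, 1] *
        !![1, (M 1 1 - 1) / M 1 0; 0, 1] := by
      ext i j
      fin_cases i <;> fin_cases j <;> simp [Matrix.mul_apply, Fin.sum_univ_two] <;> field_simp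
      · ring
      · linear_combination -hM
      · ring
    rw [e, symPowerMatrix_mul, symPowerMatrix_mul, Matrix.det_mul, Matrix.det_mul,
      det_symPowerMatrix_upper, det_symPowerMatrix_lower, det_symPowerMatrix_upper]
    simp
  by_cases hc : (A : Matrix (Fin 2) (Fin 2) K) 1 0 = 0
  · have hA := A.det_coe
    have ha : (A : Matrix (Fin 2) (Fin 2) K) 0 0 ≠ 0 := by
      intro h0
      rw [Matrix.det_fin_two, hc, h0] at hA
      simp at hA
    have h := step (!![1, 0; 1, 1] * (A : Matrix (Fin 2) (Fin 2) K))
      (by rw [Matrix.det_mul, hA]; simp [Matrix.det_fin_two])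
      (by simpa [Matrix.mul_apply, Fin.sum_univ_two, hc] using ha)
    rwa [symPowerMatrix_mul, Matrix.det_mul, det_symPowerMatrix_lower, one_mul] at h
  · exact step _ A.det_coe hc

/-- The irreducible representation `SL(2, K) → SL(n, K)` on binary forms of degree `n - 1`. -/
noncomputable def irreducibleRep (K : Type*) [Field K] (n : ℕ) : SL(2, K) →* SL(n, K) :=
  MonoidHom.mk' (fun A => ⟨symPowerMatrix n (A : Matrix (Fin 2) (Fin 2) K), det_symPowerMatrix n A⟩)
    fun A B => Subtype.ext
      ((congrArg (symPowerMatrix n) (Matrix.SpecialLinearGroup.coe_mul A B)).trans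
        (symPowerMatrix_mul n _ _))

theorem coe_irreducibleRep {K : Type*} [Field K] (n : ℕ) (A : SL(2, K)) :
    (irreducibleRep K n A : Matrix (Fin n) (Fin n) K) =
      symPowerMatrix n (A : Matrix (Fin 2) (Fin 2) K) := rfl

end SymPower

/-! ### Hitchin representations -/

/-- The topology of pointwise convergence on the space `Hom(Γ, SL(n, ℝ))`. -/
instance representationTopology (Γ : Type*) [Group Γ] (n : ℕ) :
    TopologicalSpace (Γ →* SL(n, ℝ)) :=
  TopologicalSpace.induced (fun (ρ : Γ →* SL(n, ℝ)) (γ : Γ) => ρ γ) inferInstance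

/-- A representation into `SL(2, ℝ)` that is discrete and faithful, i.e. a point of
(a lift to `SL(2, ℝ)` of) Teichmüller space. -/
def IsDiscreteFaithful {Γ : Type*} [Group Γ] (j : Γ →* SL(2, ℝ)) : Prop :=
  Function.Injective j ∧ DiscreteTopology j.range

/-- A representation of the genus `g` surface group into `SL(n, ℝ)` is Hitchin if it lies in a
Hitchin component, i.e. in the connected component in `Hom(π₁(S), SL(n, ℝ))` of the composition
of a discrete and faithful representation into `SL(2, ℝ)` with the irreducible representation
`SL(2, ℝ) → SL(n, ℝ)`. -/
def IsHitchin {g n : ℕ} (ρ : SurfaceGroup g →* SL(n, ℝ)) : Prop :=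
  ∃ j : SurfaceGroup g →* SL(2, ℝ), IsDiscreteFaithful j ∧
    ρ ∈ connectedComponent ((irreducibleRep ℝ n).comp j)

/-! It suffices to find a discrete and faithful j with image in SL(2, ℚ): the entries of a symmetric
power are integral polynomials in those of the matrix, so ι_n ∘ j is rational, and it lies in its
own component. No deformation is needed.

Such a j comes from a right-angled hexagon whose side reflections are given by traceless integral
matrices S_i with S_i² = 13 for i even and 3 for i odd. The product of two reflections of equal
parity is therefore rational of determinant 1. Suitable words in such products generate a genus two
surface group in the reflection group (`Hexagon.ofSurfaceGroup`), and they lift to SL(2, ℚ)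
(`Hexagon.fuchsianRep`). Genus g is reached by the cyclic covering of degree g - 1
(`SurfaceGroup.covering`).

Ping-pong with the half-planes of the sides shows that a nontrivial element of the Coxeter group
moves an interior point out of the hexagon, which gives faithfulness and discreteness together. The
two group embeddings are proved injective algebraically, by letting the larger group act on (cosets)
× (subgroup) as on itself by left multiplication. -/

open scoped commutatorElement

/-! ### Ping-pong for right-angled Coxeter groups -/

/-- In a right-angled Coxeter group acting on a set with half-spaces `P i`, `N i` such that
`s i` exchanges the sides of the wall `i`, preserves the sides of the walls orthogonal to it, and
the negative sides of non-orthogonal walls are disjoint: if `i` is not a left descent of `w`,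
then `w` maps the chamber to the positive side of the wall `i`. -/
theorem CoxeterSystem.apply_mem_of_not_isLeftDescent {B W X : Type*} [Group W]
    {M : CoxeterMatrix B} (cs : CoxeterSystem M W) (φ : W →* Equiv.Perm X) (P N : B → Set X)
    (hPN : ∀ i, ∀ x ∈ P i, φ (cs.simple i) x ∈ N i)
    (hP : ∀ i j, M i j = 2 → ∀ x ∈ P i, φ (cs.simple j) x ∈ P i)
    (hN : ∀ i j, i ≠ j → M i j ≠ 2 → N j ⊆ P i)
    {x : X} (hx : ∀ i, x ∈ P i) (w : W) (i : B) (hw : ¬ cs.IsLeftDescent w i) :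
    φ w x ∈ P i := by
  induction hn : cs.length w using Nat.strong_induction_on generalizing w i with
  | _ n ih =>
  by_cases h1 : w = 1
  · simpa [h1] using hx i
  obtain ⟨j, hj⟩ := cs.exists_leftDescent_of_ne_one h1
  have hij : i ≠ j := by rintro rfl; exact hw hj
  set v := cs.simple j * w with hv
  have hwv : w = cs.simple j * v := by rw [hv, cs.simple_mul_simple_cancel_left]
  have hlen : cs.length v + 1 = cs.length w := cs.isLeftDescent_iff.mp hj
  have hvj : ¬ cs.IsLeftDescent v j := (cs.isLeftDescent_iff_not_isLeftDescent_mul).mp hj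
  rw [hwv, map_mul, Equiv.Perm.mul_apply]
  by_cases hM : M i j = 2
  -- If s_i shortened v, then s_i w = s_j (s_i v) would be shorter than w, against `hw`.
  · refine hP i j hM _ (ih _ (by omega) v i ?_ rfl)
    intro hvi
    refine hw ?_
    have hcomm : cs.simple i * cs.simple j = cs.simple j * cs.simple i := by
      have h := cs.simple_mul_simple_pow i j
      rw [hM, pow_two, mul_eq_one_iff_eq_inv, mul_inv_rev, cs.inv_simple, cs.inv_simple] at h
      exact h
    have hvi' := cs.isLeftDescent_iff.mp hvi
    have h := cs.length_mul_le (cs.simple j) (cs.simple i * v)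
    rw [cs.length_simple, ← mul_assoc, ← hcomm, mul_assoc, ← hwv] at h
    unfold CoxeterSystem.IsLeftDescent
    omega
  · exact hN i j hij hM (hPN j _ (ih _ (by omega) v j hvj rfl))

/-- For a left descent i of w, the element s_i w no longer has i as a left descent, so it sends x
into `P i`; applying s_i crosses the wall. -/
theorem CoxeterSystem.exists_apply_mem_of_ne_one {B W X : Type*} [Group W]
    {M : CoxeterMatrix B} (cs : CoxeterSystem M W) (φ : W →* Equiv.Perm X) (P N : B → Set X)
    (hPN : ∀ i, ∀ x ∈ P i, φ (cs.simple i) x ∈ N i)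
    (hP : ∀ i j, M i j = 2 → ∀ x ∈ P i, φ (cs.simple j) x ∈ P i)
    (hN : ∀ i j, i ≠ j → M i j ≠ 2 → N j ⊆ P i)
    {x : X} (hx : ∀ i, x ∈ P i) {w : W} (hw : w ≠ 1) : ∃ i, φ w x ∈ N i := by
  obtain ⟨i, hi⟩ := cs.exists_leftDescent_of_ne_one hw
  refine ⟨i, ?_⟩
  have h := cs.apply_mem_of_not_isLeftDescent φ P N hPN hP hN hx _ i
    (cs.isLeftDescent_iff_not_isLeftDescent_mul.mp hi)
  simpa [← Equiv.Perm.mul_apply, ← map_mul] using hPN i _ h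

/-! ### Homomorphisms from surface groups -/

namespace SurfaceGroup

variable {g : ℕ} {G : Type*} [Group G]

/-- The generator `a_i` of the surface group. -/
abbrev a (i : Fin g) : SurfaceGroup g := PresentedGroup.of (Sum.inl i)

/-- The generator `b_i` of the surface group. -/
abbrev b (i : Fin g) : SurfaceGroup g := PresentedGroup.of (Sum.inr i)

theorem lift_surfaceRelator (f : Fin g ⊕ Fin g → G) :
    FreeGroup.lift f (surfaceRelator g) =
      (List.ofFn fun i => ⁅f (Sum.inl i), f (Sum.inr i)⁆).prod := by
  simp [surfaceRelator, map_list_prod, List.map_ofFn, Function.comp_def, commutatorElement_def]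

/-- The homomorphism from the surface group determined by a solution of its defining relation. -/
def lift (f : Fin g ⊕ Fin g → G)
    (hf : (List.ofFn fun i => ⁅f (Sum.inl i), f (Sum.inr i)⁆).prod = 1) : SurfaceGroup g →* G :=
  PresentedGroup.toGroup (f := f) (by
    rintro r rfl
    rw [lift_surfaceRelator, hf])

@[simp]
theorem lift_of (f : Fin g ⊕ Fin g → G)
    (hf : (List.ofFn fun i => ⁅f (Sum.inl i), f (Sum.inr i)⁆).prod = 1) (x : Fin g ⊕ Fin g) :
    lift f hf (PresentedGroup.of x) = f x :=
  PresentedGroup.toGroup.of _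

theorem prod_commutator_of (g : ℕ) :
    (List.ofFn fun i : Fin g => ⁅a i, b i⁆).prod = 1 := by
  have h : FreeGroup.lift PresentedGroup.of =
      PresentedGroup.mk ({surfaceRelator g} : Set (FreeGroup (Fin g ⊕ Fin g))) := by
    ext
    simp [PresentedGroup.of]
  rw [← lift_surfaceRelator PresentedGroup.of, h]
  exact PresentedGroup.one_of_mem rfl

end SurfaceGroup

/-! ### Injectivity from actions on cosets -/

/-- The permutation of `Q × Γ` covering the permutation `τ` of `Q` that is left multiplication by
`X q` on the fibre over `q`. -/
def fibrePerm {Q Γ : Type*} [Group Γ] (τ : Equiv.Perm Q) (X : Q → Γ) : Equiv.Perm (Q × Γ) :=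
  τ.prodShear fun q => Equiv.mulLeft (X q)

@[simp]
theorem fibrePerm_apply {Q Γ : Type*} [Group Γ] (τ : Equiv.Perm Q) (X : Q → Γ) (q : Q) (k : Γ) :
    fibrePerm τ X (q, k) = (τ q, X q * k) := rfl

/-- The fibrewise left multiplications of `Q × Γ`. -/
def fibreHom {Q Γ : Type*} [Group Γ] : (Q → Γ) →* Equiv.Perm (Q × Γ) where
  toFun := fibrePerm 1
  map_one' := by ext1 ⟨q, k⟩; simp
  map_mul' X Y := by ext1 ⟨q, k⟩; simp [mul_assoc]

/-- A homomorphism `f` is injective if its target acts on `Q × Γ` such that the image of each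
generator of `Γ` acts as left multiplication by that generator on one of the fibres. -/
theorem injective_of_fibre_apply {Q Γ G : Type*} [Group Γ] [Group G] (f : Γ →* G)
    (φ : G →* Equiv.Perm (Q × Γ)) (q : Q) {S : Set Γ} (hS : Subgroup.closure S = ⊤)
    (h : ∀ s ∈ S, ∀ k, φ (f s) (q, k) = (q, s * k)) : Function.Injective f := by
  have key : ∀ x : Γ, ∀ k, φ (f x) (q, k) = (q, x * k) := by
    intro x
    have hx : x ∈ Subgroup.closure S := hS ▸ Subgroup.mem_top x
    induction hx using Subgroup.closure_induction with
    | mem s hs => exact h s hs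
    | one => simp
    | mul x y _ _ hx hy => intro k; simp [hx, hy, mul_assoc]
    | inv x _ hx => intro k; rw [map_inv, map_inv, Equiv.Perm.inv_eq_iff_eq, hx]; simp
  refine (injective_iff_map_eq_one f).mpr fun x hx => ?_
  have := key x 1
  rw [hx] at this
  simpa using this.symm

/-! ### The surface group of genus `g` as a subgroup of the surface group of genus two -/

/-- Between consecutive factors the powers of x cancel to a single x. -/
theorem prod_ofFn_conj_pow {G : Type*} [Group G] (x r : G) (N : ℕ) :
    (List.ofFn fun k : Fin N => x ^ (k : ℕ) * r * (x ^ (k : ℕ))⁻¹).prod =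
      (r * x) ^ N * (x ^ N)⁻¹ := by
  induction N with
  | zero => simp
  | succ N ih =>
    rw [List.ofFn_succ_last]
    simp only [Fin.val_castSucc, Fin.val_last, List.prod_append, ih, List.prod_singleton]
    rw [pow_succ, pow_succ x]
    group

theorem commutator_mul_commutator_eq_one_iff {G : Type*} [Group G] {x y z w : G} :
    ⁅x, y⁆ * ⁅z, w⁆ = 1 ↔ ⁅z, w⁆ * (x * y) = y * x := by
  rw [mul_eq_one_iff_eq_inv, eq_comm, inv_eq_iff_mul_eq_one, commutatorElement_def x y,
    ← mul_assoc, ← mul_assoc, mul_inv_eq_one, mul_inv_eq_iff_eq_mul]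

namespace SurfaceGroup

theorem commutator_mul_commutator_two :
    ⁅(a 0 : SurfaceGroup 2), (b 0 : SurfaceGroup 2)⁆ *
      ⁅(a 1 : SurfaceGroup 2), (b 1 : SurfaceGroup 2)⁆ = 1 := by
  simpa [List.ofFn_succ] using prod_commutator_of 2

/-- The images of the generators under the embedding of the fundamental group of the cyclic
covering of degree `m + 1` of the surface of genus two. -/
def coveringGen (m : ℕ) : Fin (m + 2) ⊕ Fin (m + 2) → SurfaceGroup 2 :=
  Sum.elim
    (Fin.cons (a 0 ^ (m + 1)) fun k : Fin (m + 1) => a 0 ^ (k : ℕ) * a 1 * (a 0 ^ (k : ℕ))⁻¹)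
    (Fin.cons (b 0) fun k : Fin (m + 1) => a 0 ^ (k : ℕ) * b 1 * (a 0 ^ (k : ℕ))⁻¹)

/-- The homomorphism of fundamental groups induced by the cyclic covering of degree `m + 1` of the
surface of genus two. -/
def covering (m : ℕ) : SurfaceGroup (m + 2) →* SurfaceGroup 2 :=
  lift (coveringGen m) (by
    rw [List.ofFn_succ, List.prod_cons]
    simp only [coveringGen, Sum.elim_inl, Sum.elim_inr, Fin.cons_zero, Fin.cons_succ,
      ← conjugate_commutatorElement]
    rw [prod_ofFn_conj_pow]
    -- Hence the telescoped product is b₀ a₀^(m+1) b₀⁻¹ a₀^(-(m+1)), the inverse of the first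
    -- commutator.
    have h : ⁅(a 1 : SurfaceGroup 2), (b 1 : SurfaceGroup 2)⁆ * a 0 = b 0 * a 0 * (b 0)⁻¹ := by
      rw [eq_inv_of_mul_eq_one_right commutator_mul_commutator_two, commutatorElement_def]
      group
    rw [h, conj_pow, commutatorElement_def]
    group)

/-- The elements `(r₀ ⋯ r_{k-1})⁻¹ b₀` with `r_k = ⁅a_{k+1}, b_{k+1}⁆`. -/
def monodromy (m : ℕ) (k : Fin (m + 2)) : SurfaceGroup (m + 2) :=
  (Fin.partialProd (fun k : Fin (m + 1) => ⁅a k.succ, b k.succ⁆) k)⁻¹ * b 0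

theorem monodromy_zero (m : ℕ) : monodromy m 0 = b 0 := by
  simp [monodromy]

/-- `monodromy m k` plays the role of a₀^k b₀ a₀^(-k); this is the genus two relation [a₁,b₁] a₀ b₀
a₀⁻¹ = b₀ conjugated by a₀^k. -/
theorem commutator_mul_monodromy_succ (m : ℕ) (k : Fin (m + 1)) :
    ⁅a k.succ, b k.succ⁆ * monodromy m k.succ = monodromy m k.castSucc := by
  rw [monodromy, Fin.partialProd_succ, mul_inv_rev, mul_assoc, mul_inv_cancel_left, monodromy]

theorem monodromy_last_mul (m : ℕ) : monodromy m (Fin.last _) * a 0 = a 0 * b 0 := by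
  have h := prod_commutator_of (m + 2)
  rw [List.ofFn_succ, List.prod_cons] at h
  rw [monodromy, Fin.partialProd, Fin.val_last, List.take_of_length_le (by simp),
    eq_inv_of_mul_eq_one_right h, commutatorElement_def]
  group

/-- The action of the generators of the surface group of genus two on the cosets of the covering
group. -/
def coveringPerm (m : ℕ) :
    Fin 2 ⊕ Fin 2 → Equiv.Perm (Fin (m + 1) × SurfaceGroup (m + 2)) :=
  -- The pair (i, k) models a₀^(-i) · `covering m k`, and the permutations are left multiplications.
  -- Only a₀ changes the fibre; passing from 0 to m costs the factor a₀^(m+1), the image of the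
  -- generator `a 0`.
  Sum.elim
    ![fibrePerm (Equiv.subRight 1) (Fin.cons (a 0) fun _ => 1), fibrePerm 1 fun k => a k.succ]
    ![fibrePerm 1 fun k => monodromy m k.castSucc, fibrePerm 1 fun k => b k.succ]

theorem zero_sub_one_eq_last (m : ℕ) : (0 - 1 : Fin (m + 1)) = Fin.last m := by
  rw [sub_eq_iff_eq_add, Fin.last_add_one]

theorem succ_sub_one (m : ℕ) (k : Fin m) : (k.succ - 1 : Fin (m + 1)) = k.castSucc := by
  rw [sub_eq_iff_eq_add, Fin.coeSucc_eq_succ]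

/-- The action of the surface group of genus two on the cosets of the covering group. -/
def coveringAction (m : ℕ) :
    SurfaceGroup 2 →* Equiv.Perm (Fin (m + 1) × SurfaceGroup (m + 2)) :=
  lift (coveringPerm m) (by
    simp only [List.ofFn_succ, List.ofFn_zero, List.prod_cons, List.prod_nil, mul_one]
    rw [commutator_mul_commutator_eq_one_iff]
    ext1 ⟨i, k⟩
    have hc : ∀ (x y : Fin (m + 1) → SurfaceGroup (m + 2)) i k,
        ⁅fibrePerm 1 x, fibrePerm 1 y⁆ (i, k) = (i, ⁅x i, y i⁆ * k) := fun x y i k =>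
      congrArg (fun p : Equiv.Perm _ => p (i, k)) (map_commutatorElement fibreHom x y).symm
    simp only [coveringPerm, Sum.elim_inl, Sum.elim_inr, Fin.succ_zero_eq_one, Matrix.cons_val_zero,
      Matrix.cons_val_one, Equiv.Perm.mul_apply, fibrePerm_apply, Equiv.Perm.one_apply,
      Equiv.subRight_apply, hc]
    -- The fibre over 0, where a₀ wraps around, is the only one that uses the relation of the genus
    -- m + 2 group.
    refine Fin.cases ?_ (fun j => ?_) i
    · rw [zero_sub_one_eq_last, ← commutator_mul_monodromy_succ m (Fin.last m), Fin.succ_last,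
        Fin.cons_zero, Fin.castSucc_zero, monodromy_zero]
      simp only [mul_assoc]
      rw [← mul_assoc (a 0), ← monodromy_last_mul]
      simp only [mul_assoc]
    · obtain ⟨m, rfl⟩ : ∃ m', m = m' + 1 := ⟨m - 1, by have := j.2; omega⟩
      rw [succ_sub_one, Fin.cons_succ, one_mul, one_mul,
        ← commutator_mul_monodromy_succ (m + 1) j.castSucc, mul_assoc, Fin.succ_castSucc])

theorem coveringAction_a_one (m : ℕ) :
    coveringAction m (a 1) = fibrePerm 1 fun k => a k.succ :=
  lift_of (coveringPerm m) _ (Sum.inl 1)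

theorem coveringAction_b_one (m : ℕ) :
    coveringAction m (b 1) = fibrePerm 1 fun k => b k.succ :=
  lift_of (coveringPerm m) _ (Sum.inr 1)

theorem coveringAction_a_pow (m : ℕ) (j : ℕ) (hj : j < m + 1) (k : SurfaceGroup (m + 2)) :
    coveringAction m (a 0 ^ j) (⟨j, hj⟩, k) = (0, k) := by
  induction j with
  | zero => simp
  | succ j ih =>
    have h : (⟨j + 1, hj⟩ : Fin (m + 1)) = Fin.succ ⟨j, by omega⟩ := rfl
    have h2 : coveringAction m (a 0) (⟨j + 1, hj⟩, k) = (⟨j, by omega⟩, k) := by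
      rw [h, coveringAction, lift_of]
      simp only [coveringPerm, Sum.elim_inl, Matrix.cons_val_zero, fibrePerm_apply,
        Equiv.subRight_apply, succ_sub_one, Fin.cons_succ, one_mul]
      rfl
    rw [pow_succ, map_mul, Equiv.Perm.mul_apply, h2, ih]

theorem coveringAction_conj (m : ℕ) (x : Fin (m + 1) → SurfaceGroup (m + 2)) (y : SurfaceGroup 2)
    (hy : coveringAction m y = fibrePerm 1 x) (j : Fin (m + 1)) (k : SurfaceGroup (m + 2)) :
    coveringAction m (a 0 ^ (j : ℕ) * y * (a 0 ^ (j : ℕ))⁻¹) (0, k) = (0, x j * k) := by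
  have h : (coveringAction m (a 0 ^ (j : ℕ)))⁻¹ (0, k) = (j, k) := by
    rw [Equiv.Perm.inv_eq_iff_eq, coveringAction_a_pow m j j.2]
  rw [map_mul, map_mul, map_inv, Equiv.Perm.mul_apply, Equiv.Perm.mul_apply, h, hy, fibrePerm_apply,
    Equiv.Perm.one_apply, coveringAction_a_pow m j j.2]

/-- The conjugating power of a₀ carries fibre 0 to fibre j and back, so each generator of the
covering group multiplies fibre 0 by itself. -/
theorem covering_injective (m : ℕ) : Function.Injective (covering m) := by
  refine injective_of_fibre_apply (covering m) (coveringAction m) 0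
    (PresentedGroup.closure_range_of _) ?_
  rintro _ ⟨x | x, rfl⟩ k <;> refine Fin.cases ?_ (fun j => ?_) x <;>
    rw [covering, lift_of] <;>
    simp only [coveringGen, Sum.elim_inl, Sum.elim_inr, Fin.cons_zero, Fin.cons_succ]
  · have h : coveringAction m (a 0) (0, k) = (Fin.last m, a 0 * k) := by
      rw [coveringAction, lift_of]
      simp only [coveringPerm, Sum.elim_inl, Matrix.cons_val_zero, fibrePerm_apply,
        Equiv.subRight_apply, zero_sub_one_eq_last, Fin.cons_zero]
    rw [pow_succ, map_mul, Equiv.Perm.mul_apply, h]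
    exact coveringAction_a_pow m m (by omega) _
  · exact coveringAction_conj m _ _ (coveringAction_a_one m) j k
  · rw [coveringAction, lift_of]
    simp [coveringPerm, monodromy_zero]
  · exact coveringAction_conj m _ _ (coveringAction_b_one m) j k

end SurfaceGroup

/-! ### The right-angled hexagon group -/

namespace Hexagon

/-- The Coxeter matrix of the reflection group of a right-angled hexagon. -/
def coxeterMatrix : CoxeterMatrix (Fin 6) where
  -- Indices are cyclic modulo 6; the entry 0 means infinite order.
  M := Matrix.of fun i j => if i = j then 1 else if i = j + 1 ∨ j = i + 1 then 2 else 0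
  isSymm := by
    ext i j
    simp only [Matrix.transpose_apply, Matrix.of_apply, eq_comm (a := i), or_comm]
  diagonal i := by simp
  off_diagonal i j h := by
    simp only [Matrix.of_apply, if_neg h]
    split_ifs <;> simp

theorem coxeterMatrix_eq_two_iff {i j : Fin 6} :
    coxeterMatrix i j = 2 ↔ i = j + 1 ∨ j = i + 1 := by
  have h : ∀ i j : Fin 6, (if i = j then 1 else if i = j + 1 ∨ j = i + 1 then 2 else 0) = 2 ↔
      i = j + 1 ∨ j = i + 1 := by decide
  exact h i j

/-- The standard Coxeter system of the reflection group of a right-angled hexagon. -/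
def coxeterSystem : CoxeterSystem coxeterMatrix coxeterMatrix.Group :=
  coxeterMatrix.toCoxeterSystem

/-- The reflection in the `i`-th side of a right-angled hexagon. -/
abbrev s (i : Fin 6) : coxeterMatrix.Group := coxeterSystem.simple i

theorem s_mul_self (i : Fin 6) : s i * s i = 1 := coxeterSystem.simple_mul_simple_self i

theorem s_mul_s_succ (i : Fin 6) : s (i + 1) * s i = s i * s (i + 1) := by
  have h := coxeterSystem.simple_mul_simple_pow (i + 1) i
  rw [coxeterMatrix_eq_two_iff.mpr (Or.inl rfl), pow_two, mul_eq_one_iff_eq_inv, mul_inv_rev,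
    coxeterSystem.inv_simple, coxeterSystem.inv_simple] at h
  exact h

theorem isLiftable {G : Type*} [Group G] {f : Fin 6 → G} (hf : ∀ i, f i * f i = 1)
    (hf' : ∀ i, f i * f (i + 1) = f (i + 1) * f i) : coxeterMatrix.IsLiftable f := by
  have key : ∀ i, (f i * f (i + 1)) ^ 2 = 1 := fun i => by
    rw [pow_two, hf' i, ← hf' i, mul_assoc, hf' i, ← mul_assoc (f (i + 1)), hf, one_mul, hf]
  intro i j
  change _ ^ (if i = j then 1 else if i = j + 1 ∨ j = i + 1 then 2 else 0) = 1
  split_ifs with h1 h2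
  · rw [h1, pow_one, hf]
  · rcases h2 with rfl | rfl
    · rw [← hf', key]
    · exact key i
  · exact pow_zero _

/-- The homomorphism from the hexagon group determined by a family of involutions. -/
noncomputable def lift {G : Type*} [Group G] (f : Fin 6 → G) (hf : ∀ i, f i * f i = 1)
    (hf' : ∀ i, f i * f (i + 1) = f (i + 1) * f i) : coxeterMatrix.Group →* G :=
  coxeterSystem.lift ⟨f, isLiftable hf hf'⟩

theorem lift_s {G : Type*} [Group G] (f : Fin 6 → G) (hf : ∀ i, f i * f i = 1)
    (hf' : ∀ i, f i * f (i + 1) = f (i + 1) * f i) (i : Fin 6) : lift f hf hf' (s i) = f i :=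
  coxeterSystem.lift_apply_simple _ i

/-! ### The surface group of genus two in the hexagon group -/

/-- The images of the generators of the surface group of genus two in the hexagon group. -/
def surfaceGen : Fin 2 ⊕ Fin 2 → coxeterMatrix.Group :=
  Sum.elim
    ![s 0 * s 2, s 1 * s 3 * (s 0 * s 4) * (s 1 * s 3)⁻¹]
    ![s 1 * s 3, s 1 * s 5 * (s 1 * s 3)⁻¹]

/-- The surface group of genus two as a group of orientation-preserving symmetries of the tiling of
the hyperbolic plane by right-angled hexagons. -/
def ofSurfaceGroup : SurfaceGroup 2 →* coxeterMatrix.Group :=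
  SurfaceGroup.lift surfaceGen (by
    have inv : ∀ i, (s i)⁻¹ = s i := coxeterSystem.inv_simple
    have sq := s_mul_self
    have sq' : ∀ i w, s i * (s i * w) = w := fun i _ =>
      coxeterSystem.simple_mul_simple_cancel_left i
    have c₁ : s 1 * s 0 = s 0 * s 1 := s_mul_s_succ 0
    have c₂ : s 1 * s 2 = s 2 * s 1 := (s_mul_s_succ 1).symm
    have c₃ : s 3 * s 2 = s 2 * s 3 := s_mul_s_succ 2
    have c₄ : s 3 * s 4 = s 4 * s 3 := (s_mul_s_succ 3).symm
    have c₅ : s 5 * s 4 = s 4 * s 5 := s_mul_s_succ 4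
    have c₆ : s 5 * s 0 = s 0 * s 5 := (s_mul_s_succ 5).symm
    have assoc : ∀ {x y : coxeterMatrix.Group}, x * y = y * x → ∀ z, x * (y * z) = y * (x * z) :=
      fun h z => by rw [← mul_assoc, h, mul_assoc]
    simp [List.ofFn_succ, surfaceGen, commutatorElement_def, inv, mul_assoc, sq, sq', c₄,
      assoc c₁, assoc c₂, assoc c₃, assoc c₄, assoc c₅, assoc c₆])

/-! ### Cosets of the surface group in the hexagon group -/

section Covering

variable {Γ : Type*} [Group Γ]

/-- The action of a reflection in a side of even index on the cosets of the surface group. -/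
def evenPerm (p q : Γ) : Equiv.Perm ((Bool × Bool) × Γ) :=
  fibrePerm (Equiv.boolNot.prodCongr (Equiv.refl _)) fun x =>
    match x with
    | (false, false) => q
    | (true, false) => q⁻¹
    | (false, true) => p
    | (true, true) => p⁻¹

/-- The action of a reflection in a side of odd index on the cosets of the surface group. -/
def oddPerm (p q : Γ) : Equiv.Perm ((Bool × Bool) × Γ) :=
  fibrePerm ((Equiv.refl _).prodCongr Equiv.boolNot) fun x =>
    match x with
    | (false, false) => q
    | (true, false) => p
    | (false, true) => q⁻¹
    | (true, true) => p⁻¹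

theorem evenPerm_mul_self (p q : Γ) : evenPerm p q * evenPerm p q = 1 := by
  ext1 ⟨⟨_ | _, _ | _⟩, k⟩ <;> simp [evenPerm]

theorem oddPerm_mul_self (p q : Γ) : oddPerm p q * oddPerm p q = 1 := by
  ext1 ⟨⟨_ | _, _ | _⟩, k⟩ <;> simp [oddPerm]

/-- The hypothesis is commutation on the fibre over (false, false); the other three fibres need only
rearrangements of it. -/
theorem evenPerm_mul_oddPerm {p q r t : Γ} (h : p * r = t * q) :
    evenPerm p q * oddPerm t r = oddPerm t r * evenPerm p q := by
  have h1 : q⁻¹ * t⁻¹ = r⁻¹ * p⁻¹ := by rw [← mul_inv_rev, ← mul_inv_rev, h]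
  have h2 : p⁻¹ * t = r * q⁻¹ := by
    rw [inv_mul_eq_iff_eq_mul, ← mul_assoc, h, mul_inv_cancel_right]
  have h3 : q * r⁻¹ = t⁻¹ * p := by
    rw [eq_inv_mul_iff_mul_eq, ← mul_assoc, ← h, mul_inv_cancel_right]
  ext1 ⟨⟨_ | _, _ | _⟩, k⟩ <;> simp [evenPerm, oddPerm, ← mul_assoc, *]

end Covering

/-- The action of the reflections of the hexagon group on the cosets of the surface group of genus
two. -/
def cosetPerm : Fin 6 → Equiv.Perm ((Bool × Bool) × SurfaceGroup 2) :=
  -- The point ((ε, δ), k) models s₀^ε s₁^δ · `ofSurfaceGroup k`. The elements x₁, y₁, x₂, y₂ stand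
  -- for s₀s₂, s₁s₃, s₀s₄, s₁s₅; the second argument of each permutation is s₀s_i or s₁s_i, the
  -- first its conjugate by s₁ or s₀ respectively.
  let x₁ : SurfaceGroup 2 := .a 0
  let y₁ : SurfaceGroup 2 := .b 0
  let x₂ : SurfaceGroup 2 := y₁⁻¹ * .a 1 * y₁
  let y₂ : SurfaceGroup 2 := .b 1 * y₁
  ![evenPerm 1 1, oddPerm 1 1, evenPerm x₁ x₁, oddPerm (x₁ * y₁ * x₁⁻¹) y₁,
    evenPerm (y₂ * x₂ * y₂⁻¹) x₂, oddPerm y₂ y₂]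

/-- The action of the hexagon group on the cosets of the surface group of genus two. -/
noncomputable def cosetAction :
    coxeterMatrix.Group →* Equiv.Perm ((Bool × Bool) × SurfaceGroup 2) :=
  lift cosetPerm
    (by
      intro i
      fin_cases i
      exacts [evenPerm_mul_self _ _, oddPerm_mul_self _ _, evenPerm_mul_self _ _,
        oddPerm_mul_self _ _, evenPerm_mul_self _ _, oddPerm_mul_self _ _])
    (by
      intro i
      fin_cases i
      · exact evenPerm_mul_oddPerm rfl
      · exact (evenPerm_mul_oddPerm (by simp)).symm
      · exact evenPerm_mul_oddPerm (by simp)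
      -- Sides 3 and 4: the only neighbours whose commutation needs the surface relation.
      · refine (evenPerm_mul_oddPerm ?_).symm
        have h := eq_inv_of_mul_eq_one_left SurfaceGroup.commutator_mul_commutator_two
        rw [commutatorElement_inv, commutatorElement_def, commutatorElement_def, eq_mul_inv_iff_mul_eq]
          at h
        calc _ = (.b 1 * .a 1 * (.b 1)⁻¹) * .b 0 := by group
          _ = _ := by rw [← h]; group
      · exact evenPerm_mul_oddPerm (inv_mul_cancel_right _ _)
      · exact (evenPerm_mul_oddPerm (by simp)).symm)

theorem ofSurfaceGroup_injective : Function.Injective ofSurfaceGroup := by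
  refine injective_of_fibre_apply ofSurfaceGroup cosetAction (false, false)
    (PresentedGroup.closure_range_of _) ?_
  have h : ∀ i p, cosetAction (s i) p = cosetPerm i p := fun i p => by rw [cosetAction, lift_s]
  rintro _ ⟨x | x, rfl⟩ k <;> fin_cases x <;>
    simp only [ofSurfaceGroup, SurfaceGroup.lift_of, surfaceGen] <;>
    simp [h, cosetPerm, evenPerm, oddPerm, mul_assoc]

end Hexagon

/-! ### The geometric representation of the hexagon group -/

namespace Hexagon

/-- Traceless integral matrices acting on the hyperbolic plane as the reflections in the sides of a
right-angled hexagon. -/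
def sideMatrix : Fin 6 → Matrix (Fin 2) (Fin 2) ℤ :=
  -- Conjugation by `!![0, -1; 1, 1]`, a rotation of order three about `basePoint`, takes side i to
  -- side i - 2. The signs make all heights positive at `basePoint`.
  ![!![1, 2; 6, -1], !![2, -1; 1, -2], !![1, -6; -2, -1], !![-3, -6; 1, 3], !![-7, -6; 6, 7],
    !![-3, -1; 6, 3]]

/-- Minus the determinants of the matrices `sideMatrix i`. -/
def sideNorm : Fin 6 → ℤ := ![13, 3, 13, 3, 13, 3]

/-- The real matrix `sideMatrix i`. -/
def side (i : Fin 6) : Matrix (Fin 2) (Fin 2) ℝ := (sideMatrix i).map (Int.castRingHom ℝ)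

theorem sideNorm_pos (i : Fin 6) : 0 < sideNorm i := by
  revert i; decide

theorem side_mul_self (i : Fin 6) : side i * side i = (sideNorm i : ℝ) • 1 := by
  have h : ∀ i j k, (sideMatrix i * sideMatrix i) j k = if j = k then sideNorm i else 0 := by
    decide
  rw [side, ← Matrix.map_mul]
  ext j k
  simp only [Matrix.map_apply, h]
  simp [Matrix.one_apply, apply_ite (Int.cast : ℤ → ℝ)]

/-- Perpendicular axes; the sign disappears in the action on forms, where the reflections commute.
-/
theorem side_mul_side (i : Fin 6) : side i * side (i + 1) = -(side (i + 1) * side i) := by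
  have h : ∀ i, sideMatrix i * sideMatrix (i + 1) = -(sideMatrix (i + 1) * sideMatrix i) := by
    decide
  rw [side, side, ← Matrix.map_mul, h, ← Matrix.map_mul]
  ext j k
  simp

theorem det_side (i : Fin 6) : (side i).det = -sideNorm i := by
  have h : ∀ i, (sideMatrix i).det = -sideNorm i := by decide
  rw [side, ← RingHom.mapMatrix_apply, ← RingHom.map_det, h]
  simp

/-- The action of the reflection in the `i`-th side on binary quadratic forms. -/
noncomputable def reflect (i : Fin 6) : Equiv.Perm (Matrix (Fin 2) (Fin 2) ℝ) :=
  Function.Involutive.toPerm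
    (fun Q => (sideNorm i : ℝ)⁻¹ • (side i * Q * (side i).transpose)) (by
      intro Q
      have h : (sideNorm i : ℝ) ≠ 0 := by exact_mod_cast (sideNorm_pos i).ne'
      have h' : (side i).transpose * (side i).transpose = (sideNorm i : ℝ) • 1 := by
        rw [← Matrix.transpose_mul, side_mul_self]; simp
      simp only [Matrix.mul_smul, Matrix.smul_mul]
      rw [show side i * (side i * Q * (side i).transpose) * (side i).transpose =
        (side i * side i) * Q * ((side i).transpose * (side i).transpose) by
          simp only [Matrix.mul_assoc], side_mul_self, h']
      simp [smul_smul, h])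

theorem reflect_apply (i : Fin 6) (Q : Matrix (Fin 2) (Fin 2) ℝ) :
    reflect i Q = (sideNorm i : ℝ)⁻¹ • (side i * Q * (side i).transpose) := rfl

theorem reflect_mul_apply (i j : Fin 6) (Q : Matrix (Fin 2) (Fin 2) ℝ) :
    (reflect i * reflect j) Q = ((sideNorm i : ℝ)⁻¹ * (sideNorm j : ℝ)⁻¹) •
      ((side i * side j) * Q * (side i * side j).transpose) := by
  simp only [Equiv.Perm.mul_apply, reflect_apply, Matrix.mul_smul, Matrix.smul_mul, smul_smul,
    Matrix.transpose_mul, Matrix.mul_assoc]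

/-- The action of the hexagon group on binary quadratic forms. -/
noncomputable def geometricRep : coxeterMatrix.Group →* Equiv.Perm (Matrix (Fin 2) (Fin 2) ℝ) :=
  lift reflect
    (fun i => by
      ext1 Q
      exact (reflect i).symm_apply_apply Q)
    (fun i => by
      ext1 Q
      rw [reflect_mul_apply, reflect_mul_apply, side_mul_side, mul_comm (_⁻¹ : ℝ)]
      simp)

/-! ### Half-planes and ping-pong -/

/-- The signed distance (up to a positive function) of a point of the hyperbolic plane, given by a
positive definite symmetric matrix, from the axis of the reflection given by `S`. -/
def height (S Q : Matrix (Fin 2) (Fin 2) ℝ) : ℝ :=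
  S 1 0 * Q 0 0 + S 1 1 * (Q 0 1 + Q 1 0) - S 0 1 * Q 1 1

theorem height_smul (S Q : Matrix (Fin 2) (Fin 2) ℝ) (r : ℝ) :
    height S (r • Q) = r * height S Q := by
  simp only [height, Matrix.smul_apply, smul_eq_mul]; ring

/-- The reflection formula of a quadratic space: for traceless S and T, S T + T S is a scalar, twice
their inner product. -/
theorem height_conj (S T Q : Matrix (Fin 2) (Fin 2) ℝ) (hS : S 0 0 = -S 1 1)
    (hT : T 0 0 = -T 1 1) :
    height T (S * Q * S.transpose) =
      -S.det * height T Q - (S * T + T * S) 0 0 * height S Q := by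
  simp only [height, Matrix.mul_apply, Matrix.transpose_apply, Fin.sum_univ_two, Matrix.det_fin_two,
    Matrix.add_apply, hS, hT]
  ring

theorem side_zero_zero (i : Fin 6) : side i 0 0 = -side i 1 1 := by
  have h : ∀ i, sideMatrix i 0 0 = -sideMatrix i 1 1 := by decide
  simp [side, h]

theorem height_reflect_self (i : Fin 6) (Q : Matrix (Fin 2) (Fin 2) ℝ) :
    height (side i) (reflect i Q) = -height (side i) Q := by
  have h : (sideNorm i : ℝ) ≠ 0 := by exact_mod_cast (sideNorm_pos i).ne'
  rw [reflect_apply, height_smul, height_conj _ _ _ (side_zero_zero i) (side_zero_zero i), det_side,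
    side_mul_self]
  simp
  field_simp
  ring

theorem height_reflect_of_adjacent {i j : Fin 6} (hij : i = j + 1 ∨ j = i + 1)
    (Q : Matrix (Fin 2) (Fin 2) ℝ) : height (side i) (reflect j Q) = height (side i) Q := by
  have h : (sideNorm j : ℝ) ≠ 0 := by exact_mod_cast (sideNorm_pos j).ne'
  have h' : side j * side i + side i * side j = 0 := by
    rcases hij with rfl | rfl
    · rw [side_mul_side, neg_add_cancel]
    · rw [side_mul_side, add_neg_cancel]
  rw [reflect_apply, height_smul, height_conj _ _ _ (side_zero_zero j) (side_zero_zero i), det_side,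
    h']
  simp [h]

theorem posDef_reflect (i : Fin 6) {Q : Matrix (Fin 2) (Fin 2) ℝ} (hQ : Q.PosDef) :
    (reflect i Q).PosDef := by
  have h : (0 : ℝ) < sideNorm i := by exact_mod_cast sideNorm_pos i
  have hu : IsUnit (side i) := by
    rw [Matrix.isUnit_iff_isUnit_det, det_side, isUnit_iff_ne_zero]
    exact neg_ne_zero.mpr h.ne'
  rw [reflect_apply, ← Matrix.conjTranspose_eq_transpose_of_trivial]
  exact (hQ.mul_mul_conjTranspose_same (Matrix.vecMul_injective_of_isUnit hu)).smul (inv_pos.mpr h)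

/-- By AM-GM, (2β Q₀₁)² ≤ 4αγ Q₀₀Q₁₁ ≤ (α Q₀₀ + γ Q₁₁)². -/
theorem psd_pairing_nonneg {α β γ : ℝ} (hα : 0 ≤ α) (hγ : 0 ≤ γ) (h : β ^ 2 ≤ α * γ)
    {Q : Matrix (Fin 2) (Fin 2) ℝ} (hQ : Q.PosDef) :
    0 ≤ α * Q 0 0 + β * (Q 0 1 + Q 1 0) + γ * Q 1 1 := by
  have h0 := hQ.diag_pos (i := 0)
  have h1 := hQ.diag_pos (i := 1)
  have hd := hQ.det_pos
  have hs : Q 1 0 = Q 0 1 := by simpa using hQ.isHermitian.apply 0 1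
  rw [Matrix.det_fin_two, hs] at hd
  rw [hs]
  have hle : (2 * (β * Q 0 1)) ^ 2 ≤ (α * Q 0 0 + γ * Q 1 1) ^ 2 := by
    have := mul_le_mul h (by linarith : Q 0 1 * Q 0 1 ≤ Q 0 0 * Q 1 1) (mul_self_nonneg _)
      (mul_nonneg hα hγ)
    nlinarith [sq_nonneg (α * Q 0 0 - γ * Q 1 1)]
  have := abs_le_of_sq_le_sq' hle (by positivity)
  linarith [this.1]

/-- Some positive combination of the two heights is the pairing with a semidefinite form, hence
nonnegative, so the negative half-planes are disjoint. -/
theorem height_pos_of_not_adjacent {i j : Fin 6} (hij : i ≠ j) (h : ¬ (i = j + 1 ∨ j = i + 1))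
    {Q : Matrix (Fin 2) (Fin 2) ℝ} (hQ : Q.PosDef) (hj : height (side j) Q < 0) :
    0 < height (side i) Q := by
  -- Any positive weights making all these forms semidefinite would do.
  let p : Fin 6 → ℤ := ![2, 7, 2, 7, 2, 7]
  let A := p i • sideMatrix i + p j • sideMatrix j
  have key : ∀ i j : Fin 6, i ≠ j → ¬ (i = j + 1 ∨ j = i + 1) →
      0 ≤ (p i • sideMatrix i + p j • sideMatrix j) 1 0 ∧
      0 ≤ -(p i • sideMatrix i + p j • sideMatrix j) 0 1 ∧
      (p i • sideMatrix i + p j • sideMatrix j) 1 1 ^ 2 ≤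
        (p i • sideMatrix i + p j • sideMatrix j) 1 0 *
          -(p i • sideMatrix i + p j • sideMatrix j) 0 1 := by
    decide
  have hp : ∀ i, 0 < p i := by decide
  obtain ⟨h1, h2, h3⟩ := key i j hij h
  have hi' : (0 : ℝ) < p i := by exact_mod_cast hp i
  have hj' : (0 : ℝ) < p j := by exact_mod_cast hp j
  have := psd_pairing_nonneg (α := (A 1 0 : ℤ)) (β := (A 1 1 : ℤ)) (γ := (-A 0 1 : ℤ))
    (by exact_mod_cast h1) (by exact_mod_cast h2) (by exact_mod_cast h3) hQ
  have e : ((A 1 0 : ℤ) : ℝ) * Q 0 0 + (A 1 1 : ℤ) * (Q 0 1 + Q 1 0) + (-A 0 1 : ℤ) * Q 1 1 =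
      p i * height (side i) Q + p j * height (side j) Q := by
    simp only [A, height, side, Matrix.add_apply, Matrix.smul_apply, smul_eq_mul, Matrix.map_apply,
      eq_intCast]
    push_cast
    ring
  rw [e] at this
  by_contra hcon
  nlinarith [mul_neg_of_pos_of_neg hj' hj, mul_nonpos_of_nonneg_of_nonpos hi'.le (not_lt.mp hcon)]

/-- A point in the interior of the hexagon. -/
def basePoint : Matrix (Fin 2) (Fin 2) ℝ := !![2, -1; -1, 2]

theorem posDef_basePoint : basePoint.PosDef := by
  rw [Matrix.posDef_iff_dotProduct_mulVec]
  refine ⟨by ext i j; fin_cases i <;> fin_cases j <;> simp [basePoint], fun x hx => ?_⟩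
  have h : x 0 ≠ 0 ∨ x 1 ≠ 0 := by
    by_contra! h
    exact hx (by ext i; fin_cases i <;> simp [h.1, h.2])
  simp [basePoint, Matrix.mulVec, dotProduct, Fin.sum_univ_two]
  rcases h with h | h
  · nlinarith [sq_nonneg (x 0 - x 1), sq_pos_of_ne_zero h, sq_nonneg (x 1), sq_nonneg (x 0 - 2 * x 1)]
  · nlinarith [sq_nonneg (x 0 - x 1), sq_pos_of_ne_zero h, sq_nonneg (x 0), sq_nonneg (x 0 - 2 * x 1)]

theorem height_basePoint_pos (i : Fin 6) : 0 < height (side i) basePoint := by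
  fin_cases i <;> simp [height, side, sideMatrix, basePoint] <;> norm_num

/-- Nontrivial elements of the hexagon group move the base point out of the hexagon. -/
theorem exists_height_neg {w : coxeterMatrix.Group} (hw : w ≠ 1) :
    ∃ i, height (side i) (geometricRep w basePoint) < 0 := by
  have hs : ∀ i, geometricRep (coxeterSystem.simple i) = reflect i := lift_s _ _ _
  obtain ⟨i, hi⟩ := coxeterSystem.exists_apply_mem_of_ne_one geometricRep
    (fun i => {Q | Q.PosDef ∧ 0 < height (side i) Q})
    (fun i => {Q | Q.PosDef ∧ height (side i) Q < 0})
    (fun i Q hQ => by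
      rw [hs]
      exact ⟨posDef_reflect i hQ.1, by rw [height_reflect_self]; exact neg_neg_of_pos hQ.2⟩)
    (fun i j hij Q hQ => by
      rw [hs]
      refine ⟨posDef_reflect j hQ.1, ?_⟩
      rw [height_reflect_of_adjacent (coxeterMatrix_eq_two_iff.mp hij)]
      exact hQ.2)
    (fun i j hij hM Q hQ =>
      ⟨hQ.1, height_pos_of_not_adjacent hij (mt coxeterMatrix_eq_two_iff.mpr hM) hQ.1 hQ.2⟩)
    (fun i => ⟨posDef_basePoint, height_basePoint_pos i⟩) hw
  exact ⟨i, hi.2⟩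

/-! ### A discrete and faithful rational representation of the surface group -/

/-- The action of `SL(2, ℝ)` on binary quadratic forms. -/
def formAction : SL(2, ℝ) →* Equiv.Perm (Matrix (Fin 2) (Fin 2) ℝ) :=
  MonoidHom.toHomPerm
    { toFun := fun A Q => A.1 * Q * A.1.transpose
      map_one' := by
        funext Q
        change (1 : Matrix _ _ _) * Q * (1 : Matrix _ _ _).transpose = Q
        simp
      map_mul' := fun A B => by
        funext Q
        change (A.1 * B.1) * Q * (A.1 * B.1).transpose =
          A.1 * (B.1 * Q * B.1.transpose) * A.1.transpose
        simp only [Matrix.mul_assoc, Matrix.transpose_mul] }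

theorem formAction_apply (A : SL(2, ℝ)) (Q : Matrix (Fin 2) (Fin 2) ℝ) :
    formAction A Q = A.1 * Q * A.1.transpose := rfl

/-- The base change of `SL(2)` from `ℚ` to `ℝ`. -/
noncomputable abbrev toReal : SL(2, ℚ) →* SL(2, ℝ) :=
  Matrix.SpecialLinearGroup.map (algebraMap ℚ ℝ)

/-- Equal norms make the normalizing factor of the product rational, so no square root appears. -/
theorem formAction_toReal {i j : Fin 6} (hij : sideNorm i = sideNorm j) (A : SL(2, ℚ))
    (hA : (sideNorm i : ℚ) • A.1 = (sideMatrix i * sideMatrix j).map (Int.castRingHom ℚ)) :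
    formAction (toReal A) = geometricRep (s i * s j) := by
  have h : (sideNorm i : ℝ) ≠ 0 := by exact_mod_cast (sideNorm_pos i).ne'
  have hA' : side i * side j = (sideNorm i : ℝ) • (toReal A).1 := by
    have := congrArg (fun M => M.map (algebraMap ℚ ℝ)) hA
    rw [side, side, ← Matrix.map_mul]
    ext k l
    have := congrFun (congrFun this k) l
    simpa using this.symm
  ext1 Q
  rw [geometricRep, map_mul, lift_s, lift_s, reflect_mul_apply, hA', ← hij, formAction_apply]
  simp [smul_smul, h, mul_assoc]

/-- The product of the reflections in the sides 0 and 2 of the hexagon. -/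
def product02 : SL(2, ℚ) := ⟨!![-3/13, -8/13; 8/13, -35/13], by norm_num [Matrix.det_fin_two]⟩

theorem coe_product02 : (product02 : Matrix (Fin 2) (Fin 2) ℚ) = !![-3/13, -8/13; 8/13, -35/13] := rfl

/-- The product of the reflections in the sides 0 and 4 of the hexagon. -/
def product04 : SL(2, ℚ) := ⟨!![5/13, 8/13; -48/13, -43/13], by norm_num [Matrix.det_fin_two]⟩

theorem coe_product04 : (product04 : Matrix (Fin 2) (Fin 2) ℚ) = !![5/13, 8/13; -48/13, -43/13] := rfl

/-- The product of the reflections in the sides 1 and 3 of the hexagon. -/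
def product13 : SL(2, ℚ) := ⟨!![-7/3, -5; -5/3, -4], by norm_num [Matrix.det_fin_two]⟩

theorem coe_product13 : (product13 : Matrix (Fin 2) (Fin 2) ℚ) = !![-7/3, -5; -5/3, -4] := rfl

/-- The product of the reflections in the sides 1 and 5 of the hexagon. -/
def product15 : SL(2, ℚ) := ⟨!![-4, -5/3; -5, -7/3], by norm_num [Matrix.det_fin_two]⟩

theorem coe_product15 : (product15 : Matrix (Fin 2) (Fin 2) ℚ) = !![-4, -5/3; -5, -7/3] := rfl

theorem formAction_product02 : formAction (toReal product02) = geometricRep (s 0 * s 2) :=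
  formAction_toReal (i := 0) (j := 2) rfl product02 (by
    rw [coe_product02]
    ext i j
    fin_cases i <;> fin_cases j <;> simp [sideNorm, sideMatrix] <;> norm_num)

theorem formAction_product04 : formAction (toReal product04) = geometricRep (s 0 * s 4) :=
  formAction_toReal (i := 0) (j := 4) rfl product04 (by
    rw [coe_product04]
    ext i j
    fin_cases i <;> fin_cases j <;> simp [sideNorm, sideMatrix] <;> norm_num)

theorem formAction_product13 : formAction (toReal product13) = geometricRep (s 1 * s 3) :=
  formAction_toReal (i := 1) (j := 3) rfl product13 (by
    rw [coe_product13]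
    ext i j
    fin_cases i <;> fin_cases j <;> simp [sideNorm, sideMatrix] <;> norm_num)

theorem formAction_product15 : formAction (toReal product15) = geometricRep (s 1 * s 5) :=
  formAction_toReal (i := 1) (j := 5) rfl product15 (by
    rw [coe_product15]
    ext i j
    fin_cases i <;> fin_cases j <;> simp [sideNorm, sideMatrix] <;> norm_num)

/-- The images of the generators of the surface group of genus two in `SL(2, ℚ)`. -/
def fuchsianGen : Fin 2 ⊕ Fin 2 → SL(2, ℚ) :=
  Sum.elim ![product02, product13 * product04 * product13⁻¹] ![product13, product15 * product13⁻¹]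

/-- A rational Fuchsian representation of the surface group of genus two. -/
def fuchsianRep : SurfaceGroup 2 →* SL(2, ℚ) :=
  SurfaceGroup.lift fuchsianGen (by
    -- The action on forms does not see -1, so the relation must be checked on the matrices
    -- themselves.
    have h : product02 * product13 * product02⁻¹ * product04 =
        product15 * product04 * product15⁻¹ * product13 := by
      ext i j
      fin_cases i <;> fin_cases j <;>
        simp [coe_product02, coe_product04, coe_product13, coe_product15] <;> norm_num
    simp only [List.ofFn_succ, List.ofFn_zero, List.prod_cons, List.prod_nil, mul_one]
    change ⁅product02, product13⁆ *
      ⁅product13 * product04 * product13⁻¹, product15 * product13⁻¹⁆ = 1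
    calc _ = product02 * product13 * product02⁻¹ * product04 * product13⁻¹ *
          (product15 * product04 * product15⁻¹)⁻¹ := by
          simp only [commutatorElement_def]; group
      _ = 1 := by rw [h]; group)

theorem formAction_fuchsianRep (x : SurfaceGroup 2) :
    formAction (toReal (fuchsianRep x)) = geometricRep (ofSurfaceGroup x) := by
  suffices formAction.comp (toReal.comp fuchsianRep) = geometricRep.comp ofSurfaceGroup from
    DFunLike.congr_fun this x
  refine PresentedGroup.ext fun x => ?_
  simp only [MonoidHom.comp_apply, fuchsianRep, ofSurfaceGroup, SurfaceGroup.lift_of]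
  rcases x with x | x <;> fin_cases x
  · exact formAction_product02
  · change formAction (toReal (product13 * product04 * product13⁻¹)) =
      geometricRep (s 1 * s 3 * (s 0 * s 4) * (s 1 * s 3)⁻¹)
    rw [map_mul geometricRep, map_mul geometricRep (s 1 * s 3), map_inv geometricRep,
      ← formAction_product04, ← formAction_product13]
    simp only [map_mul, map_inv]
  · exact formAction_product13
  · change formAction (toReal (product15 * product13⁻¹)) =
      geometricRep (s 1 * s 5 * (s 1 * s 3)⁻¹)
    rw [map_mul geometricRep (s 1 * s 5), map_inv geometricRep, ← formAction_product15,
      ← formAction_product13]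
    simp only [map_mul, map_inv]

theorem eq_one_of_height_pos {x : SurfaceGroup 2}
    (hx : ∀ i, 0 < height (side i) (formAction (toReal (fuchsianRep x)) basePoint)) : x = 1 := by
  by_contra h
  obtain ⟨i, hi⟩ := exists_height_neg ((map_ne_one_iff _ ofSurfaceGroup_injective).mpr h)
  rw [← formAction_fuchsianRep] at hi
  exact lt_asymm hi (hx i)

/-- The matrices keeping `basePoint` inside the hexagon form an open set that meets the image only
in 1. -/
theorem isDiscreteFaithful_comp {Γ : Type*} [Group Γ] (f : Γ →* SurfaceGroup 2)
    (hf : Function.Injective f) : IsDiscreteFaithful ((toReal.comp fuchsianRep).comp f) := by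
  constructor
  · refine (injective_iff_map_eq_one _).mpr fun x hx => ?_
    refine (map_eq_one_iff f hf).mp (eq_one_of_height_pos fun i => ?_)
    rw [show toReal (fuchsianRep (f x)) = 1 from hx]
    simpa using height_basePoint_pos i
  · refine discreteTopology_of_isOpen_singleton_one ?_
    have hopen : IsOpen {A : SL(2, ℝ) | ∀ i, 0 < height (side i) (formAction A basePoint)} := by
      simp only [Set.ofPred_forall]
      refine isOpen_iInter_of_finite fun i => isOpen_lt continuous_const ?_
      simp only [height, formAction_apply]
      have hc : Continuous fun A : SL(2, ℝ) => A.1 * basePoint * A.1.transpose :=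
        (continuous_subtype_val.matrix_mul continuous_const).matrix_mul
          continuous_subtype_val.matrix_transpose
      have hc' := fun k l => hc.matrix_elem k l
      fun_prop
    convert hopen.preimage continuous_subtype_val
    ext ⟨_, x, rfl⟩
    simp only [Set.mem_singleton_iff, Set.mem_preimage, Set.mem_ofPred_eq]
    constructor
    · intro h i
      rw [show ((toReal.comp fuchsianRep).comp f) x = 1 from congrArg Subtype.val h]
      simpa using height_basePoint_pos i
    · intro h
      have := eq_one_of_height_pos h
      ext1
      simp [this]

end Hexagon

/-! ### Rationality of symmetric powers and conclusion -/

theorem symPowerMatrix_map {R S : Type*} [CommRing R] [CommRing S] (φ : R →+* S) (n : ℕ)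
    (A : Matrix (Fin 2) (Fin 2) R) :
    symPowerMatrix n (A.map φ) = (symPowerMatrix n A).map φ := by
  ext k i
  simp only [symPowerMatrix, Matrix.of_apply, Matrix.map_apply, ← Polynomial.coeff_map]
  simp

theorem lemma3p3 (g : ℕ) (hg : 2 ≤ g) (n : ℕ) (hn : 2 ≤ n) :
    ∃ ρ : SurfaceGroup g →* SL(n, ℝ), IsHitchin ρ ∧
      ρ.range ≤ (Matrix.SpecialLinearGroup.map (n := Fin n) (algebraMap ℚ ℝ)).range := by
  obtain ⟨m, rfl⟩ := Nat.exists_eq_add_of_le' hg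
  -- The representation is the base point ι_n ∘ j of its component.
  refine ⟨_, ⟨_, Hexagon.isDiscreteFaithful_comp _ (SurfaceGroup.covering_injective m),
    mem_connectedComponent⟩, ?_⟩
  rintro _ ⟨x, rfl⟩
  exact ⟨irreducibleRep ℚ n (Hexagon.fuchsianRep (SurfaceGroup.covering m x)),
    Subtype.ext (symPowerMatrix_map (algebraMap ℚ ℝ) n _).symm⟩
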